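/- Let $k$ be a field of characteristic $0$, $R$ a commutative $k$-algebra, $P$ a finitely generated projective $R$-module, $P^\vee=\mathrm{Hom}_R(P,R)$, and $S=\mathrm{Sym}_R(P^\vee)$. Consider $R$ as an $S$-algebra through the zero section $S\to R$, $P^\vee\mapsto 0$. The fancy Koszul cdga $\mathrm{K}(R;P)$ is the non-positively graded commutative differential graded $S$-algebra $S\otimes_R\bigwedge^\bullet P^\vee$, with $S\otimes_R\bigwedge^{n}P^\vee$ in cohomological degree $-n$ and with the $S$-linear differential $$d\bigl(a\otimes(\beta_1\wedge\dots\wedge\beta_{n})\bigr)=\sum_j a\,\alpha_j\otimes\sum_{i=1}^{n}(-1)^{i}\beta_i(x_j)\,\beta_1\wedge\dots\wedge\check{\beta_i}\wedge\dots\wedge\beta_{n},$$ where $\sum_j\alpha_j\otimes x_j\in P^\vee\otimes_R P$ corresponds to $\mathrm{id}_P$ under $P^\vee\otimes_R P\simeq\mathrm{Hom}_R(P,P)$. Let $\mathbf{cdga}_S$ be the category of non-positively graded cdga's over $S$, with its standard model structure: weak equivalences are the quasi-isomorphisms, fibrations are the morphisms that are surjective in all degrees $<0$, and cofibrations are the morphisms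 with the left lifting property with respect to the fibrations that are weak equivalences. Then the augmentation $\mathrm{K}(R;P)\to S\to R$ is a cofibrant resolution of $R$ in $\mathbf{cdga}_S$: $\mathrm{K}(R;P)$ is a cofibrant object, and the augmentation is a weak equivalence and a fibration. In particular $H^m(\mathrm{K}(R;P))=0$ for $m<0$, and $H^0(\mathrm{K}(R;P))\simeq R$ as $S$-modules. -/

import Mathlib

open CategoryTheory CategoryTheory.Limits HomotopicalAlgebra
open scoped TensorProduct

universe u v

/-! ### Non-positively graded commutative dg algebras -/

/-- A non-positively graded commutative differential graded algebra over a commutative ring `S`.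
The grading is written homologically: `deg n` is the component of cohomological degree `-n`, so
that the differential, which raises the cohomological degree by `1`, maps `deg (n + 1)` into
`deg n` and vanishes on `deg 0`. -/
structure CDGA (S : Type u) [CommRing S] where
  /-- the direct sum of all the graded components -/
  carrier : Type u
  [ring : Ring carrier]
  [algebra : Algebra S carrier]
  /-- `deg n` is the component of cohomological degree `-n` -/
  deg : ℕ → Submodule S carrier
  [graded : GradedAlgebra deg]
  /-- the differential -/
  d : carrier →ₗ[S] carrier
  d_mem : ∀ {n : ℕ} {a : carrier}, a ∈ deg (n + 1) → d a ∈ deg n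
  d_zero : ∀ {a : carrier}, a ∈ deg 0 → d a = 0
  d_d : ∀ a : carrier, d (d a) = 0
  leibniz : ∀ {m : ℕ} {a : carrier} (b : carrier), a ∈ deg m →
    d (a * b) = d a * b + (-1) ^ m * (a * d b)
  graded_comm : ∀ {m n : ℕ} {a b : carrier}, a ∈ deg m → b ∈ deg n →
    a * b = (-1) ^ (m * n) * (b * a)

namespace CDGA

attribute [instance] CDGA.ring CDGA.algebra CDGA.graded

variable {S : Type u} [CommRing S]

/-- A morphism of cdga's over `S`: a morphism of `S`-algebras which preserves the degrees and
commutes with the differentials. -/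
@[ext]
structure Hom (A B : CDGA S) where
  toAlgHom : A.carrier →ₐ[S] B.carrier
  map_deg : ∀ {n : ℕ} {a : A.carrier}, a ∈ A.deg n → toAlgHom a ∈ B.deg n
  map_d : ∀ a : A.carrier, toAlgHom (A.d a) = B.d (toAlgHom a)

instance : Category (CDGA S) where
  Hom A B := Hom A B
  id A :=
    { toAlgHom := AlgHom.id S A.carrier
      map_deg := fun h => h
      map_d := fun _ => rfl }
  comp f g :=
    { toAlgHom := g.toAlgHom.comp f.toAlgHom
      map_deg := fun h => g.map_deg (f.map_deg h)
      map_d := fun a => by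
        rw [AlgHom.comp_apply, AlgHom.comp_apply, f.map_d, g.map_d] }

/-- The differential `deg (n + 1) → deg n`. -/
def dRestrict (A : CDGA S) (n : ℕ) : A.deg (n + 1) →ₗ[S] A.deg n :=
  A.d.restrict fun _ h => A.d_mem h

/-- The component in degree `n` of a morphism of cdga's. -/
def Hom.restrict {A B : CDGA S} (f : Hom A B) (n : ℕ) : A.deg n →ₗ[S] B.deg n :=
  f.toAlgHom.toLinearMap.restrict fun _ h => f.map_deg h

lemma dRestrict_comp (A : CDGA S) (n : ℕ) :
    ModuleCat.ofHom (A.dRestrict (n + 1)) ≫ ModuleCat.ofHom (A.dRestrict n) = 0 := by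
  refine ModuleCat.hom_ext (LinearMap.ext fun x => Subtype.ext ?_)
  exact A.d_d x.1

lemma Hom.restrict_comp {A B : CDGA S} (f : Hom A B) (n : ℕ) :
    ModuleCat.ofHom (Hom.restrict f (n + 1)) ≫ ModuleCat.ofHom (B.dRestrict n) =
      ModuleCat.ofHom (A.dRestrict n) ≫ ModuleCat.ofHom (Hom.restrict f n) := by
  refine ModuleCat.hom_ext (LinearMap.ext fun x => Subtype.ext ?_)
  exact (f.map_d x.1).symm

/-- The complex of `S`-modules underlying a cdga. Its homology in degree `n` is the cohomology of
the cdga in degree `-n`. -/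
noncomputable def toComplex (S : Type u) [CommRing S] :
    CDGA S ⥤ ChainComplex (ModuleCat.{u} S) ℕ where
  obj A := ChainComplex.of (fun n => ModuleCat.of S (A.deg n))
    (fun n => ModuleCat.ofHom (A.dRestrict n)) A.dRestrict_comp
  map {A B} f := ChainComplex.ofHom (fun n => ModuleCat.ofHom (Hom.restrict f n)) (fun n => by
    dsimp only [ChainComplex.of]
    rw [ChainComplex.of_d, ChainComplex.of_d]
    exact Hom.restrict_comp f n)
  map_id A := by
    ext n x
    rfl
  map_comp f g := by
    ext n x
    rfl

/-! ### Weak equivalences, fibrations and cofibrations -/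

/-- The weak equivalences of cdga's are the quasi-isomorphisms. -/
instance : CategoryWithWeakEquivalences (CDGA S) where
  weakEquivalences := fun _ _ f => QuasiIso ((toComplex S).map f)

/-- The fibrations of cdga's are the morphisms which are surjective in every negative cohomological
degree. -/
instance : CategoryWithFibrations (CDGA S) where
  fibrations := fun _ _ f => ∀ n : ℕ, 0 < n → Function.Surjective (Hom.restrict f n)

/-- The cofibrations of cdga's are the morphisms which have the left lifting property with respect
to all the morphisms that are both fibrations and weak equivalences. -/
instance : CategoryWithCofibrations (CDGA S) where
  cofibrations := (trivialFibrations (CDGA S)).llp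

/-! ### Algebras as cdga's concentrated in degree zero -/

/-- The trivial grading, concentrated in degree `0`. -/
def trivialDeg (S B : Type u) [CommRing S] [CommRing B] [Algebra S B] (n : ℕ) : Submodule S B :=
  if n = 0 then ⊤ else ⊥

lemma trivialDeg_zero (S B : Type u) [CommRing S] [CommRing B] [Algebra S B] (b : B) :
    b ∈ trivialDeg S B 0 := by
  simp [trivialDeg]

lemma eq_zero_of_mem_trivialDeg {S B : Type u} [CommRing S] [CommRing B] [Algebra S B] {n : ℕ}
    {b : B} (hn : n ≠ 0) (hb : b ∈ trivialDeg S B n) : b = 0 := by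
  simpa [trivialDeg, hn] using hb

instance trivialDeg.gradedAlgebra (S B : Type u) [CommRing S] [CommRing B] [Algebra S B] :
    GradedAlgebra (trivialDeg S B) where
  one_mem := trivialDeg_zero S B 1
  mul_mem := by
    intro i j a b ha hb
    by_cases hi : i = 0
    · by_cases hj : j = 0
      · subst hi hj
        exact trivialDeg_zero S B _
      · rw [eq_zero_of_mem_trivialDeg hj hb, mul_zero]
        exact zero_mem _
    · rw [eq_zero_of_mem_trivialDeg hi ha, zero_mul]
      exact zero_mem _
  decompose' b := DirectSum.of (fun n => trivialDeg S B n) 0 ⟨b, trivialDeg_zero S B b⟩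
  left_inv b := by simp
  right_inv x := by
    induction x using DirectSum.induction_on with
    | zero =>
      rw [map_zero]
      exact map_zero (DirectSum.of (fun n => trivialDeg S B n) 0)
    | of i x =>
      obtain ⟨x, hx⟩ := x
      by_cases hi : i = 0
      · subst hi
        simp
      · obtain rfl := eq_zero_of_mem_trivialDeg hi hx
        have h0 : (⟨0, hx⟩ : trivialDeg S B i) = 0 := rfl
        rw [h0, map_zero, map_zero]
        exact map_zero (DirectSum.of (fun n => trivialDeg S B n) 0)
    | add x y hx hy =>
      rw [map_add]
      refine Eq.trans ?_ (congrArg₂ (· + ·) hx hy)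
      exact map_add (DirectSum.of (fun n => trivialDeg S B n) 0) ⟨_, trivialDeg_zero S B _⟩
        ⟨_, trivialDeg_zero S B _⟩

/-- A commutative `S`-algebra, viewed as a cdga over `S` concentrated in degree `0`. -/
def ofAlgebra (S B : Type u) [CommRing S] [CommRing B] [Algebra S B] : CDGA S where
  carrier := B
  deg := trivialDeg S B
  d := 0
  d_mem := fun _ => zero_mem _
  d_zero := fun _ => rfl
  d_d := fun _ => rfl
  leibniz := fun b _ => by simp
  graded_comm := by
    intro m n a b ha hb
    by_cases hm : m = 0
    · subst hm
      simp [mul_comm]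
    · rw [eq_zero_of_mem_trivialDeg hm ha]
      simp

/-- A morphism out of the base ring `S`. -/
def fromBase (A : CDGA S) : ofAlgebra S S ⟶ A :=
  Hom.mk (A := ofAlgebra S S) (Algebra.ofId S A.carrier)
    (by
      intro n a ha
      by_cases hn : n = 0
      · subst hn
        exact SetLike.algebraMap_mem_graded A.deg a
      · obtain rfl : a = 0 := eq_zero_of_mem_trivialDeg (B := S) hn ha
        have h : Algebra.ofId S A.carrier 0 ∈ A.deg n := by
          rw [map_zero]
          exact zero_mem _
        exact h)
    (by
      intro a
      exact (map_zero (Algebra.ofId S A.carrier)).trans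
        (A.d_zero (SetLike.algebraMap_mem_graded A.deg a)).symm)

/-- The base ring `S`, concentrated in degree `0`, is the initial cdga over `S`. -/
def isInitialBase : IsInitial (ofAlgebra S S) :=
  IsInitial.ofUniqueHom fromBase (fun A f => by
    apply Hom.ext
    exact Subsingleton.elim (α := S →ₐ[S] A.carrier) f.toAlgHom (fromBase A).toAlgHom)

instance : HasInitial (CDGA S) := isInitialBase.hasInitial

end CDGA

/-! ### The fancy Koszul cdga -/

namespace FancyKoszul

section Exterior

variable {R M : Type*} [CommRing R] [AddCommGroup M] [Module R M]

open ExteriorAlgebra in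
lemma ι_mul_comm (x : M) {n : ℕ} {b : ExteriorAlgebra R M} (hb : b ∈ ⋀[R]^n M) :
    ι R x * b = (-1) ^ n * (b * ι R x) := by
  induction hb using Submodule.pow_induction_on_left' with
  | algebraMap r => simp [Algebra.commutes]
  | add _ _ _ _ _ ihx ihy => rw [mul_add, ihx, ihy, add_mul, mul_add]
  | mem_mul m hm i y _ ih =>
    obtain ⟨z, rfl⟩ := hm
    have h := eq_neg_of_add_eq_zero_left (ι_add_mul_swap (R := R) x z)
    rw [← mul_assoc, h, neg_mul, mul_assoc, ih, pow_succ]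
    have hc : ι R z * (-1) ^ i = (-1) ^ i * ι R z := ((Commute.neg_one_right _).pow_right i).eq
    rw [← mul_assoc (ι R z), hc]
    simp [mul_assoc]

lemma graded_comm {m n : ℕ} {a b : ExteriorAlgebra R M} (ha : a ∈ ⋀[R]^m M)
    (hb : b ∈ ⋀[R]^n M) : a * b = (-1) ^ (m * n) * (b * a) := by
  induction ha using Submodule.pow_induction_on_left' with
  | algebraMap r => simp [Algebra.commutes]
  | add _ _ _ _ _ ihx ihy => rw [add_mul, ihx, ihy, mul_add, mul_add]
  | mem_mul x hx i y _ ih =>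
    obtain ⟨z, rfl⟩ := hx
    have hc : ExteriorAlgebra.ι R z * (-1) ^ (i * n) = (-1) ^ (i * n) * ExteriorAlgebra.ι R z :=
      ((Commute.neg_one_right _).pow_right _).eq
    rw [mul_assoc, ih, ← mul_assoc, hc, mul_assoc, ← mul_assoc _ b, ι_mul_comm z hb, Nat.succ_mul,
      pow_add]
    simp only [mul_assoc]

/-- Contraction of an exterior form by a linear form on the generators,
`β₁ ∧ ⋯ ∧ βₙ ↦ ∑ₖ (-1)ᵏ⁻¹ f(βₖ) β₁ ∧ ⋯ ∧ β̌ₖ ∧ ⋯ ∧ βₙ`. -/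
noncomputable def contract (f : Module.Dual R M) : ExteriorAlgebra R M →ₗ[R] ExteriorAlgebra R M :=
  CliffordAlgebra.contractLeft (Q := (0 : QuadraticForm R M)) f

lemma contract_leibniz (f : Module.Dual R M) {m : ℕ} {a : ExteriorAlgebra R M}
    (b : ExteriorAlgebra R M) (ha : a ∈ ⋀[R]^m M) :
    contract f (a * b) = contract f a * b + (-1) ^ m * (a * contract f b) := by
  induction ha using Submodule.pow_induction_on_left' with
  | algebraMap r =>
    simp only [contract, CliffordAlgebra.contractLeft_algebraMap_mul,
      CliffordAlgebra.contractLeft_algebraMap, zero_mul, zero_add, pow_zero, one_mul]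
  | add _ _ _ _ _ ihx ihy =>
    rw [add_mul, map_add, ihx, ihy, map_add, add_mul, add_mul, mul_add]
    abel
  | mem_mul x hx i y _ ih =>
    obtain ⟨z, rfl⟩ := hx
    have h (w : ExteriorAlgebra R M) : contract f (ExteriorAlgebra.ι R z * w) =
        f z • w - ExteriorAlgebra.ι R z * contract f w :=
      CliffordAlgebra.contractLeft_ι_mul f z w
    have hc : ExteriorAlgebra.ι R z * (-1) ^ i = (-1) ^ i * ExteriorAlgebra.ι R z :=
      ((Commute.neg_one_right _).pow_right _).eq
    rw [mul_assoc, h, ih, h, mul_add, ← mul_assoc _ ((-1) ^ i), hc, sub_mul, pow_succ,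
      smul_mul_assoc]
    simp only [mul_assoc, neg_mul, one_mul, mul_neg]
    abel

lemma contract_mem (f : Module.Dual R M) {m : ℕ} {a : ExteriorAlgebra R M}
    (ha : a ∈ ⋀[R]^(m + 1) M) : contract f a ∈ ⋀[R]^m M := by
  induction m generalizing a with
  | zero =>
    rw [zero_add, ExteriorAlgebra.exteriorPower, pow_one] at ha
    obtain ⟨z, rfl⟩ := ha
    rw [contract, ExteriorAlgebra.ι, CliffordAlgebra.contractLeft_ι]
    exact SetLike.algebraMap_mem_graded (fun n => ⋀[R]^n M) (f z)
  | succ m ih =>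
    rw [ExteriorAlgebra.exteriorPower, pow_succ'] at ha
    induction ha using Submodule.mul_induction_on' with
    | mem_mul_mem x hx y hy =>
      obtain ⟨z, rfl⟩ := hx
      have h : contract f (ExteriorAlgebra.ι R z * y) =
          f z • y - ExteriorAlgebra.ι R z * contract f y :=
        CliffordAlgebra.contractLeft_ι_mul f z y
      rw [h]
      refine sub_mem (Submodule.smul_mem _ _ hy) ?_
      rw [ExteriorAlgebra.exteriorPower, pow_succ']
      exact Submodule.mul_mem_mul ⟨z, rfl⟩ (ih hy)
    | add x _ y _ hx hy =>
      rw [map_add]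
      exact add_mem hx hy

lemma contract_of_mem_zero (f : Module.Dual R M) {a : ExteriorAlgebra R M}
    (ha : a ∈ ⋀[R]^0 M) : contract f a = 0 := by
  rw [ExteriorAlgebra.exteriorPower, pow_zero] at ha
  obtain ⟨r, rfl⟩ := Submodule.mem_one.1 ha
  exact CliffordAlgebra.contractLeft_algebraMap (Q := (0 : QuadraticForm R M)) f r

end Exterior

variable (R P : Type u) [CommRing R] [AddCommGroup P] [Module R P]

/-- The symmetric algebra `S = Sym_R(P^∨)`. -/
abbrev SymDual : Type u := SymmetricAlgebra R (Module.Dual R P)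

/-- The exterior algebra `⋀ P^∨`. -/
abbrev ExtDual : Type u := ExteriorAlgebra R (Module.Dual R P)

/-- The algebra `S ⊗_R ⋀ P^∨`. -/
abbrev KoszulAlg : Type u := SymDual R P ⊗[R] ExtDual R P

/-- The component `S ⊗_R ⋀ⁿ P^∨` of cohomological degree `-n`. -/
abbrev deg (n : ℕ) : Submodule (SymDual R P) (KoszulAlg R P) :=
  (⋀[R]^n (Module.Dual R P)).baseChange (SymDual R P)

variable {R P} in
lemma deg_eq_span (n : ℕ) : deg R P n = Submodule.span (SymDual R P)
    (TensorProduct.mk R (SymDual R P) (ExtDual R P) 1 '' (⋀[R]^n (Module.Dual R P))) :=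
  Submodule.baseChange_eq_span _ _

/-- The operator `a ⊗ ω ↦ a α ⊗ (x ⌟ ω)` for `α` in `P^∨` and `x` in `P`. -/
noncomputable def op (α : Module.Dual R P) (x : P) : KoszulAlg R P →ₗ[SymDual R P] KoszulAlg R P :=
  SymmetricAlgebra.ι R (Module.Dual R P) α •
    (contract (Module.Dual.eval R P x)).baseChange (SymDual R P)

variable {R P}

lemma op_tmul (α : Module.Dual R P) (x : P) (a : SymDual R P) (w : ExtDual R P) :
    op R P α x (a ⊗ₜ w) =
      (a * SymmetricAlgebra.ι R _ α) ⊗ₜ contract (Module.Dual.eval R P x) w := by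
  rw [op, LinearMap.smul_apply, LinearMap.baseChange_tmul, TensorProduct.smul_tmul', smul_eq_mul,
    mul_comm]

lemma contract_add (f g : Module.Dual R (Module.Dual R P)) :
    contract (f + g) = contract f + contract g := by
  simp only [contract, map_add]

lemma contract_smul (r : R) (f : Module.Dual R (Module.Dual R P)) :
    contract (r • f) = r • contract f := by
  simp only [contract, map_smul]

variable (R P) in
/-- The map `P^∨ ⊗ P → End_S(S ⊗ ⋀ P^∨)` sending `α ⊗ x` to the operator
`a ⊗ ω ↦ a α ⊗ (x ⌟ ω)`. -/
noncomputable def opTensor :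
    Module.Dual R P ⊗[R] P →ₗ[R] (KoszulAlg R P →ₗ[SymDual R P] KoszulAlg R P) :=
  TensorProduct.lift (LinearMap.mk₂ R (op R P)
    (fun α β x => by
      ext w
      simp [op_tmul, mul_add, TensorProduct.add_tmul])
    (fun r α x => by
      ext w
      simp [op_tmul, TensorProduct.smul_tmul'])
    (fun α x y => by
      ext w
      simp [op_tmul, contract_add, TensorProduct.tmul_add])
    (fun r α x => by
      ext w
      simp [op_tmul, contract_smul]))

variable (R) in
lemma opTensor_tmul (α : Module.Dual R P) (x : P) : opTensor R P (α ⊗ₜ x) = op R P α x := rfl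

lemma opTensor_mem (t : Module.Dual R P ⊗[R] P) {n : ℕ} {a : KoszulAlg R P} (ha : a ∈ deg R P (n + 1)) :
    opTensor R P t a ∈ deg R P n := by
  induction t with
  | zero => simp
  | add t t' ht ht' =>
    rw [map_add, LinearMap.add_apply]
    exact add_mem ht ht'
  | tmul α x =>
    rw [deg_eq_span] at ha
    induction ha using Submodule.span_induction with
    | zero => simp
    | add a b _ _ ha hb =>
      rw [map_add]
      exact add_mem ha hb
    | smul c a _ ha =>
      rw [map_smul]
      exact Submodule.smul_mem _ _ ha
    | mem a ha =>
      obtain ⟨w, hw, rfl⟩ := ha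
      rw [TensorProduct.mk_apply, opTensor_tmul, op_tmul]
      exact Submodule.tmul_mem_baseChange_of_mem _ (contract_mem _ hw)

lemma opTensor_of_mem_zero (t : Module.Dual R P ⊗[R] P) {a : KoszulAlg R P} (ha : a ∈ deg R P 0) :
    opTensor R P t a = 0 := by
  induction t with
  | zero => simp
  | add t t' ht ht' => rw [map_add, LinearMap.add_apply, ht, ht', add_zero]
  | tmul α x =>
    rw [deg_eq_span] at ha
    induction ha using Submodule.span_induction with
    | zero => simp
    | add a b _ _ ha hb => rw [map_add, ha, hb, add_zero]
    | smul c a _ ha => rw [map_smul, ha, smul_zero]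
    | mem a ha =>
      obtain ⟨w, hw, rfl⟩ := ha
      rw [TensorProduct.mk_apply, opTensor_tmul, op_tmul, contract_of_mem_zero _ hw,
        TensorProduct.tmul_zero]

lemma op_op (α β : Module.Dual R P) (x y : P) (a : KoszulAlg R P) :
    op R P α x (op R P β y a) = - op R P β y (op R P α x a) := by
  induction a using TensorProduct.induction_on with
  | zero => simp
  | add a b ha hb => simp only [map_add, ha, hb, neg_add]
  | tmul a w =>
    rw [op_tmul, op_tmul, op_tmul, op_tmul, mul_right_comm, ← TensorProduct.tmul_neg]
    exact congrArg _ (CliffordAlgebra.contractLeft_comm (Q := (0 : QuadraticForm R _)) _ _ w)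

lemma op_op_self (α : Module.Dual R P) (x : P) (a : KoszulAlg R P) :
    op R P α x (op R P α x a) = 0 := by
  induction a using TensorProduct.induction_on with
  | zero => simp
  | add a b ha hb => simp only [map_add, ha, hb, add_zero]
  | tmul a w =>
    have h : contract (Module.Dual.eval R P x) (contract (Module.Dual.eval R P x) w) = 0 :=
      CliffordAlgebra.contractLeft_contractLeft (Q := (0 : QuadraticForm R _)) _ w
    rw [op_tmul, op_tmul, h, TensorProduct.tmul_zero]

lemma opTensor_opTensor (t t' : Module.Dual R P ⊗[R] P) (a : KoszulAlg R P) :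
    opTensor R P t (opTensor R P t' a) = - opTensor R P t' (opTensor R P t a) := by
  induction t with
  | zero => simp
  | add t u ht hu => simp only [map_add, LinearMap.add_apply, ht, hu, neg_add]
  | tmul α x =>
    induction t' with
    | zero => simp
    | add t u ht hu => simp only [map_add, LinearMap.add_apply, ht, hu, neg_add]
    | tmul β y => exact op_op α β x y a

lemma opTensor_opTensor_self (t : Module.Dual R P ⊗[R] P) (a : KoszulAlg R P) :
    opTensor R P t (opTensor R P t a) = 0 := by
  induction t with
  | zero => simp
  | add t u ht hu =>
    simp only [map_add, LinearMap.add_apply, ht, hu, zero_add, add_zero]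
    rw [opTensor_opTensor u t, neg_add_cancel]
  | tmul α x => exact op_op_self α x a

lemma neg_one_pow_eq (m : ℕ) : ((-1) ^ m : KoszulAlg R P) = 1 ⊗ₜ ((-1) ^ m) := by
  have h := map_pow (Algebra.TensorProduct.includeRight : ExtDual R P →ₐ[R] KoszulAlg R P) (-1) m
  rw [map_neg, map_one] at h
  exact h.symm

lemma opTensor_leibniz (t : Module.Dual R P ⊗[R] P) {m : ℕ} {a : KoszulAlg R P} (b : KoszulAlg R P)
    (ha : a ∈ deg R P m) :
    opTensor R P t (a * b) = opTensor R P t a * b + (-1) ^ m * (a * opTensor R P t b) := by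
  induction t with
  | zero => simp
  | add t u ht hu =>
    simp only [map_add, LinearMap.add_apply, ht, hu, add_mul, mul_add]
    abel
  | tmul α x =>
    rw [deg_eq_span] at ha
    induction ha using Submodule.span_induction with
    | zero => simp
    | add a c _ _ ha hc =>
      simp only [map_add, ha, hc, add_mul, mul_add]
      abel
    | smul c a _ ha =>
      simp only [smul_mul_assoc, mul_smul_comm, map_smul, ha, smul_add]
    | mem a ha =>
      obtain ⟨w, hw, rfl⟩ := ha
      induction b using TensorProduct.induction_on with
      | zero => simp
      | add b c hb hc =>
        simp only [map_add, mul_add, hb, hc]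
        abel
      | tmul s v =>
        have h1 : ((-1) ^ m : KoszulAlg R P) = 1 ⊗ₜ ((-1) ^ m) := neg_one_pow_eq _
        simp only [TensorProduct.mk_apply, opTensor_tmul, op_tmul,
          Algebra.TensorProduct.tmul_mul_tmul, h1, one_mul, contract_leibniz _ v hw,
          TensorProduct.tmul_add]
        rw [mul_comm s]

lemma alg_graded_comm {m n : ℕ} {a b : KoszulAlg R P} (ha : a ∈ deg R P m) (hb : b ∈ deg R P n) :
    a * b = (-1) ^ (m * n) * (b * a) := by
  rw [deg_eq_span] at ha hb
  induction ha using Submodule.span_induction with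
  | zero => simp
  | add a c _ _ ha hc => simp only [ha, hc, add_mul, mul_add]
  | smul c a _ ha => simp only [smul_mul_assoc, mul_smul_comm, ha]
  | mem a ha =>
    obtain ⟨w, hw, rfl⟩ := ha
    induction hb using Submodule.span_induction with
    | zero => simp
    | add a c _ _ ha hc => simp only [ha, hc, add_mul, mul_add]
    | smul c a _ ha => simp only [smul_mul_assoc, mul_smul_comm, ha]
    | mem b hb =>
      obtain ⟨v, hv, rfl⟩ := hb
      have h1 : ((-1) ^ (m * n) : KoszulAlg R P) = 1 ⊗ₜ ((-1) ^ (m * n)) := neg_one_pow_eq _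
      simp only [TensorProduct.mk_apply, Algebra.TensorProduct.tmul_mul_tmul, h1, one_mul]
      rw [graded_comm hw hv]

variable (R P)

/-- The element `h(1) = ∑ⱼ αⱼ ⊗ xⱼ` of `P^∨ ⊗ P`, corresponding to the identity of `P` under the
canonical isomorphism `P^∨ ⊗ P ≃ Hom(P, P)`. -/
noncomputable def coev [Module.Finite R P] [Module.Projective R P] : Module.Dual R P ⊗[R] P :=
  (dualTensorHomEquiv R P P).symm LinearMap.id

/-- The differential of the fancy Koszul cdga,
`a ⊗ (β₁ ∧ ⋯ ∧ βₙ) ↦ ∑ⱼ a αⱼ ⊗ ∑ₖ (-1)ᵏ βₖ(xⱼ) (β₁ ∧ ⋯ ∧ β̌ₖ ∧ ⋯ ∧ βₙ)`,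
where `h(1) = ∑ⱼ αⱼ ⊗ xⱼ`. -/
noncomputable def differential [Module.Finite R P] [Module.Projective R P] :
    KoszulAlg R P →ₗ[SymDual R P] KoszulAlg R P :=
  - opTensor R P (coev R P)

variable [Module.Finite R P] [Module.Projective R P]

lemma differential_apply (a : KoszulAlg R P) :
    differential R P a = - opTensor R P (coev R P) a := rfl

lemma differential_leibniz {m : ℕ} {a : KoszulAlg R P} (b : KoszulAlg R P)
    (ha : a ∈ deg R P m) :
    differential R P (a * b) =
      differential R P a * b + (-1) ^ m * (a * differential R P b) := by
  have h {A : Type u} [Ring A] (x y z e w : A) : - (x * y + e * (z * w)) =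
      -x * y + e * (z * -w) := by
    rw [neg_mul, mul_neg, mul_neg, neg_add]
  rw [differential_apply, differential_apply, differential_apply, opTensor_leibniz _ b ha]
  exact h _ _ _ _ _

lemma differential_differential (a : KoszulAlg R P) :
    differential R P (differential R P a) = 0 := by
  rw [differential_apply, differential_apply, map_neg, opTensor_opTensor_self, neg_neg]

end FancyKoszul

open FancyKoszul in
/-- The fancy Koszul cdga `K(R; P) = (S ⊗_R ⋀ P^∨, d)` over `S = Sym_R(P^∨)`. -/
noncomputable def fancyKoszul (R P : Type u) [CommRing R] [AddCommGroup P] [Module R P]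
    [Module.Finite R P] [Module.Projective R P] : CDGA (SymDual R P) where
  carrier := KoszulAlg R P
  deg := deg R P
  d := differential R P
  d_mem := fun h => neg_mem (opTensor_mem _ h)
  d_zero := fun h => neg_eq_zero.2 (opTensor_of_mem_zero _ h)
  d_d := differential_differential R P
  leibniz := fun b h => differential_leibniz R P b h
  graded_comm := alg_graded_comm

/-- The ring `R`, viewed as an algebra over `Sym_R(P^∨)` by the zero section `P^∨ → R`. -/
def ZeroSection (R P : Type u) [CommRing R] [AddCommGroup P] [Module R P] : Type u := R

namespace ZeroSection

variable (R P : Type u) [CommRing R] [AddCommGroup P] [Module R P]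

instance : CommRing (ZeroSection R P) := inferInstanceAs (CommRing R)

instance : Algebra R (ZeroSection R P) := inferInstanceAs (Algebra R R)

noncomputable instance : Algebra (FancyKoszul.SymDual R P) (ZeroSection R P) :=
  (SymmetricAlgebra.lift (0 : Module.Dual R P →ₗ[R] ZeroSection R P)).toRingHom.toAlgebra

instance : IsScalarTower R (FancyKoszul.SymDual R P) (ZeroSection R P) :=
  IsScalarTower.of_algebraMap_eq fun r =>
    ((SymmetricAlgebra.lift (0 : Module.Dual R P →ₗ[R] ZeroSection R P)).commutes r).symm

/-- The ring `R` as a cdga over `Sym_R(P^∨)`, concentrated in degree `0`. -/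
noncomputable def cdga : CDGA (FancyKoszul.SymDual R P) :=
  CDGA.ofAlgebra (FancyKoszul.SymDual R P) (ZeroSection R P)

end ZeroSection

namespace FancyKoszul

variable (R P : Type u) [CommRing R] [AddCommGroup P] [Module R P]

/-- The augmentation `⋀ P^∨ → ⋀⁰ P^∨ = R` of the exterior algebra. -/
noncomputable def extAug : ExtDual R P →ₐ[R] ZeroSection R P :=
  ExteriorAlgebra.lift R ⟨0, fun _ => by simp⟩

/-- The augmentation `S ⊗_R ⋀ P^∨ → S → R`, as a morphism of `S`-algebras. -/
noncomputable def aug : KoszulAlg R P →ₐ[SymDual R P] ZeroSection R P :=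
  Algebra.TensorProduct.lift (Algebra.ofId (SymDual R P) (ZeroSection R P)) (extAug R P)
    (fun _ _ => Commute.all _ _)

variable {R P}

lemma extAug_eq_zero {n : ℕ} {w : ExtDual R P} (hw : w ∈ ⋀[R]^(n + 1) (Module.Dual R P)) :
    extAug R P w = 0 := by
  rw [ExteriorAlgebra.exteriorPower, pow_succ'] at hw
  induction hw using Submodule.mul_induction_on' with
  | mem_mul_mem x hx y hy =>
    obtain ⟨z, rfl⟩ := hx
    rw [map_mul, extAug, ExteriorAlgebra.lift_ι_apply, LinearMap.zero_apply, zero_mul]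
  | add x _ y _ hx hy => rw [map_add, hx, hy, add_zero]

lemma aug_eq_zero {n : ℕ} {a : KoszulAlg R P} (ha : a ∈ deg R P (n + 1)) : aug R P a = 0 := by
  rw [deg_eq_span] at ha
  induction ha using Submodule.span_induction with
  | zero => simp
  | add a b _ _ ha hb => rw [map_add, ha, hb, add_zero]
  | smul c a _ ha => rw [map_smul, ha, smul_zero]
  | mem a ha =>
    obtain ⟨w, hw, rfl⟩ := ha
    rw [TensorProduct.mk_apply, aug, Algebra.TensorProduct.lift_tmul, extAug_eq_zero hw, mul_zero]

lemma aug_opTensor (t : Module.Dual R P ⊗[R] P) (a : KoszulAlg R P) :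
    aug R P (opTensor R P t a) = 0 := by
  induction t with
  | zero => simp
  | add t u ht hu => rw [map_add, LinearMap.add_apply, map_add, ht, hu, add_zero]
  | tmul α x =>
    induction a using TensorProduct.induction_on with
    | zero => simp
    | add a b ha hb => rw [map_add, map_add, ha, hb, add_zero]
    | tmul a w =>
      have h : Algebra.ofId (SymDual R P) (ZeroSection R P) (SymmetricAlgebra.ι R _ α) = 0 :=
        SymmetricAlgebra.lift_ι_apply _ α
      rw [opTensor_tmul, op_tmul, aug, Algebra.TensorProduct.lift_tmul, map_mul, h, mul_zero,
        zero_mul]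

variable (R P)

lemma aug_differential [Module.Finite R P] [Module.Projective R P] (a : KoszulAlg R P) :
    aug R P (differential R P a) = 0 := by
  rw [differential_apply, map_neg, aug_opTensor, neg_zero]

/-- The augmentation `K(R; P) → R`, as a morphism of cdga's over `S = Sym_R(P^∨)`. -/
noncomputable def augmentation [Module.Finite R P] [Module.Projective R P] :
    fancyKoszul R P ⟶ ZeroSection.cdga R P :=
  CDGA.Hom.mk (A := fancyKoszul R P) (B := ZeroSection.cdga R P) (aug R P)
    (by
      intro n a ha
      cases n with
      | zero => exact CDGA.trivialDeg_zero (SymDual R P) (ZeroSection R P) _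
      | succ n =>
        have h : aug R P a ∈ CDGA.trivialDeg (SymDual R P) (ZeroSection R P) (n + 1) := by
          rw [aug_eq_zero ha]
          exact zero_mem _
        exact h)
    (by
      intro a
      exact aug_differential R P a)

end FancyKoszul

/-! ### Quasi-isomorphisms of complexes of modules, in terms of elements -/

namespace CategoryTheory.ShortComplex

/-! Resolution. Write `id_P = ∑ αᵢ ⊗ xᵢ`, so that `δ = -d` is `a ⊗ ω ↦ ∑ a αᵢ ⊗ (xᵢ ⌟ ω)`. The de
Rham operator `H (a ⊗ ω) = ∑ ∂ₓᵢ a ⊗ αᵢ ∧ ω` satisfies `δH + Hδ = E` (`euler_eq`), where `E` is the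
Euler operator, equal to `m + n` on `Symᵐ ⊗ ⋀ⁿ`. Positive integers are invertible in `R`, so only
the weight `m + n = 0`, that is `R`, contributes to homology. Instead of splitting an element into
weights, one uses polynomials in `E`: every element is sent to `R` by some `p(E)` with `p(0) = 1`
(`exists_aeval_euler`), and `p(E) z` is homologous to `z` for every cycle `z`
(`LinearMap.aeval_sub_mem_range_of_homotopy`). The augmentation is the identity on `R` and kills
boundaries, so a cycle that it kills is a boundary (`exists_differential_eq`).

Cofibrancy. Since 2 is invertible, the Koszul cdga is free over `S` on the generators `P^∨` in
cohomological degree `-1`, with `dβ = -β`: a morphism to `A` is an `R`-linear map `φ` from `P^∨` to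
`A.deg 1` with `d (φ β) = -β`. Along a trivial fibration each single value of `φ` can be lifted
(`CDGA.exists_lift_of_trivialFibration`), and projectivity of `P^∨` makes the choices linear
(`exists_lift`). -/

lemma moduleCatLeftHomologyData_π_eq_zero_iff {A : Type u} [Ring A]
    (S : ShortComplex (ModuleCat.{v} A)) (x : S.moduleCatLeftHomologyData.K) :
    S.moduleCatLeftHomologyData.π x = 0 ↔
      ∃ y : S.X₁, S.f y = S.moduleCatLeftHomologyData.i x := by
  refine (Submodule.Quotient.mk_eq_zero _).trans ⟨?_, ?_⟩
  · rintro ⟨y, rfl⟩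
    exact ⟨y, rfl⟩
  · rintro ⟨y, hy⟩
    exact ⟨y, Subtype.ext hy⟩

/-- Elementwise characterization of the quasi-isomorphisms of short complexes of modules. -/
lemma moduleCat_quasiIso_iff {A : Type u} [Ring A] {S T : ShortComplex (ModuleCat.{v} A)}
    (φ : S ⟶ T) :
    QuasiIso φ ↔
      (∀ x : S.X₂, S.g x = 0 → ∀ y : T.X₁, T.f y = φ.τ₂ x → ∃ x' : S.X₁, S.f x' = x) ∧
      (∀ y : T.X₂, T.g y = 0 → ∃ x : S.X₂, S.g x = 0 ∧ ∃ y' : T.X₁, y = φ.τ₂ x + T.f y') := by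
  have lift (U : ShortComplex (ModuleCat.{v} A)) (x : U.X₂) (hx : U.g x = 0) :
      ∃ k, U.moduleCatLeftHomologyData.i k = x :=
    ⟨(⟨x, hx⟩ : LinearMap.ker U.g.hom), rfl⟩
  have hg (U : ShortComplex (ModuleCat.{v} A)) (k) :
      U.g (U.moduleCatLeftHomologyData.i k) = 0 :=
    ConcreteCategory.congr_hom U.moduleCatLeftHomologyData.wi k
  have hπ (U : ShortComplex (ModuleCat.{v} A)) :
      Function.Surjective U.moduleCatLeftHomologyData.π := Submodule.mkQ_surjective _
  have h0S := S.moduleCatLeftHomologyData_π_eq_zero_iff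
  have h0T := T.moduleCatLeftHomologyData_π_eq_zero_iff
  have γ : LeftHomologyMapData φ S.moduleCatLeftHomologyData T.moduleCatLeftHomologyData := default
  have liftS := lift S
  have liftT := lift T
  have hgS := hg S
  have hgT := hg T
  have hπS := hπ S
  have hπT := hπ T
  clear hg hπ lift
  -- From here only the lifting, cycle and vanishing properties recorded above matter, so the
  -- concrete kernels and quotients are made opaque.
  generalize S.moduleCatLeftHomologyData = D at *
  generalize T.moduleCatLeftHomologyData = E at *
  have hK (x) : E.i (γ.φK x) = φ.τ₂ (D.i x) := ConcreteCategory.congr_hom γ.commi x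
  have hH (x) : γ.φH (D.π x) = E.π (γ.φK x) := ConcreteCategory.congr_hom γ.commπ x
  rw [γ.quasiIso_iff, ConcreteCategory.isIso_iff_bijective, Function.Bijective]
  refine and_congr ?_ ?_
  · rw [injective_iff_map_eq_zero]
    constructor
    · intro h x hx y hy
      obtain ⟨k, rfl⟩ := liftS x hx
      refine (h0S k).1 (h _ ?_)
      rw [hH, h0T, hK]
      exact ⟨y, hy⟩
    · intro h z hz
      obtain ⟨x, rfl⟩ := hπS z
      rw [hH, h0T, hK] at hz
      obtain ⟨y, hy⟩ := hz
      exact (h0S x).2 (h _ (hgS x) y hy)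
  · constructor
    · intro h y hy
      obtain ⟨l, rfl⟩ := liftT y hy
      obtain ⟨z, hz⟩ := h (E.π l)
      obtain ⟨x, rfl⟩ := hπS z
      rw [hH] at hz
      have hz' := sub_eq_zero.2 hz.symm
      rw [← map_sub, h0T, map_sub, hK] at hz'
      obtain ⟨y', hy'⟩ := hz'
      exact ⟨D.i x, hgS x, y', by rw [hy', add_sub_cancel]⟩
    · intro h z
      obtain ⟨l, rfl⟩ := hπT z
      obtain ⟨x, hx, y', hy'⟩ := h (E.i l) (hgT l)
      obtain ⟨k, rfl⟩ := liftS x hx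
      refine ⟨D.π k, Eq.symm ?_⟩
      rw [hH, ← sub_eq_zero, ← map_sub, h0T, map_sub, hK]
      exact ⟨y', by rw [hy', add_sub_cancel_left]⟩

end CategoryTheory.ShortComplex

/-! ### Cycles, boundaries and lifting in cdga's -/

namespace CDGA

variable {S : Type u} [CommRing S]

lemma toComplex_d (A : CDGA S) (n : ℕ) :
    ((toComplex S).obj A).d (n + 1) n = ModuleCat.ofHom (A.dRestrict n) :=
  ChainComplex.of_d (fun n => ModuleCat.of S (A.deg n)) (fun n => ModuleCat.ofHom (A.dRestrict n)) n

lemma toComplex_d_apply (A : CDGA S) (n : ℕ) (a : A.deg (n + 1)) :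
    (((toComplex S).obj A).d (n + 1) n a : A.deg n) = A.dRestrict n a := by
  rw [toComplex_d]
  rfl

lemma exactAt_succ_iff (A : CDGA S) (n : ℕ) :
    ((toComplex S).obj A).ExactAt (n + 1) ↔
      ∀ a ∈ A.deg (n + 1), A.d a = 0 → ∃ b ∈ A.deg (n + 2), A.d b = a := by
  rw [HomologicalComplex.exactAt_iff' _ (n + 2) (n + 1) n (by simp) (by simp),
    ShortComplex.moduleCat_exact_iff]
  constructor
  · intro h a ha hd
    obtain ⟨b, hb⟩ := h (⟨a, ha⟩ : A.deg (n + 1))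
      ((toComplex_d_apply A n ⟨a, ha⟩).trans (Subtype.ext hd))
    exact ⟨b.1, b.2, congrArg Subtype.val ((toComplex_d_apply A (n + 1) b).symm.trans hb)⟩
  · intro h a ha
    obtain ⟨b, hb, hd⟩ := h a.1 a.2
      (congrArg Subtype.val ((toComplex_d_apply A n a).symm.trans ha))
    exact ⟨(⟨b, hb⟩ : A.deg (n + 2)), (toComplex_d_apply A (n + 1) _).trans (Subtype.ext hd)⟩

/-- No cycle condition appears: everything in degree 0 is a cycle. -/
lemma quasiIsoAt_zero_iff {A B : CDGA S} (f : A ⟶ B) :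
    QuasiIsoAt ((toComplex S).map f) 0 ↔
      (∀ a ∈ A.deg 0, ∀ b ∈ B.deg 1, B.d b = f.toAlgHom a → ∃ a' ∈ A.deg 1, A.d a' = a) ∧
      (∀ b ∈ B.deg 0, ∃ a ∈ A.deg 0, ∃ b' ∈ B.deg 1, b = f.toAlgHom a + B.d b') := by
  -- The index 0 has no successor and counts as its own; the differential from 0 to 0 vanishes.
  rw [quasiIsoAt_iff' _ 1 0 0 (by simp) (by simp), ShortComplex.moduleCat_quasiIso_iff]
  have h0 (C : CDGA S) (c : C.deg 0) : ((toComplex S).obj C).d 0 0 c = 0 := by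
    rw [HomologicalComplex.shape _ _ _ (by simp)]
    rfl
  refine and_congr ?_ ?_
  · constructor
    · intro h a ha b hb hab
      obtain ⟨a', ha'⟩ := h (⟨a, ha⟩ : A.deg 0) (h0 A _) (⟨b, hb⟩ : B.deg 1)
        ((toComplex_d_apply B 0 _).trans (Subtype.ext hab))
      exact ⟨a'.1, a'.2, congrArg Subtype.val ((toComplex_d_apply A 0 a').symm.trans ha')⟩
    · intro h a _ b hab
      obtain ⟨a', ha', hd⟩ := h a.1 a.2 b.1 b.2
        (congrArg Subtype.val ((toComplex_d_apply B 0 b).symm.trans hab))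
      exact ⟨(⟨a', ha'⟩ : A.deg 1), (toComplex_d_apply A 0 _).trans (Subtype.ext hd)⟩
  · constructor
    · intro h b hb
      obtain ⟨a, -, b', hb'⟩ := h (⟨b, hb⟩ : B.deg 0) (h0 B _)
      refine ⟨a.1, a.2, b'.1, b'.2, congrArg Subtype.val (show (⟨b, hb⟩ : B.deg 0) =
        Hom.restrict f 0 a + B.dRestrict 0 b' from hb'.trans ?_)⟩
      exact congrArg (Hom.restrict f 0 a + ·) (toComplex_d_apply B 0 b')
    · intro h b _
      obtain ⟨a, ha, b', hb', hab⟩ := h b.1 b.2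
      refine ⟨(⟨a, ha⟩ : A.deg 0), h0 A _, (⟨b', hb'⟩ : B.deg 1), ?_⟩
      refine Eq.trans (Subtype.ext hab) (congrArg (Hom.restrict f 0 ⟨a, ha⟩ + ·)
        (toComplex_d_apply B 0 ⟨b', hb'⟩).symm)

lemma quasiIsoAt_succ_iff {A B : CDGA S} (f : A ⟶ B) (n : ℕ) :
    QuasiIsoAt ((toComplex S).map f) (n + 1) ↔
      (∀ a ∈ A.deg (n + 1), A.d a = 0 → ∀ b ∈ B.deg (n + 2), B.d b = f.toAlgHom a →
        ∃ a' ∈ A.deg (n + 2), A.d a' = a) ∧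
      (∀ b ∈ B.deg (n + 1), B.d b = 0 → ∃ a ∈ A.deg (n + 1), A.d a = 0 ∧
        ∃ b' ∈ B.deg (n + 2), b = f.toAlgHom a + B.d b') := by
  rw [quasiIsoAt_iff' _ (n + 2) (n + 1) n (by simp) (by simp),
    ShortComplex.moduleCat_quasiIso_iff]
  refine and_congr ?_ ?_
  · constructor
    · intro h a ha hd b hb hab
      obtain ⟨a', ha'⟩ := h (⟨a, ha⟩ : A.deg (n + 1))
        ((toComplex_d_apply A n ⟨a, ha⟩).trans (Subtype.ext hd)) (⟨b, hb⟩ : B.deg (n + 2))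
        ((toComplex_d_apply B (n + 1) _).trans (Subtype.ext hab))
      exact ⟨a'.1, a'.2, congrArg Subtype.val ((toComplex_d_apply A (n + 1) a').symm.trans ha')⟩
    · intro h a hd b hab
      obtain ⟨a', ha', hd⟩ := h a.1 a.2
        (congrArg Subtype.val ((toComplex_d_apply A n a).symm.trans hd)) b.1 b.2
        (congrArg Subtype.val ((toComplex_d_apply B (n + 1) b).symm.trans hab))
      exact ⟨(⟨a', ha'⟩ : A.deg (n + 2)), (toComplex_d_apply A (n + 1) _).trans (Subtype.ext hd)⟩
  · constructor
    · intro h b hb hd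
      obtain ⟨a, ha, b', hb'⟩ := h (⟨b, hb⟩ : B.deg (n + 1))
        ((toComplex_d_apply B n _).trans (Subtype.ext hd))
      refine ⟨a.1, a.2, congrArg Subtype.val ((toComplex_d_apply A n a).symm.trans ha),
        b'.1, b'.2, congrArg Subtype.val (show (⟨b, hb⟩ : B.deg (n + 1)) =
        Hom.restrict f (n + 1) a + B.dRestrict (n + 1) b' from hb'.trans ?_)⟩
      exact congrArg (Hom.restrict f (n + 1) a + ·) (toComplex_d_apply B (n + 1) b')
    · intro h b hd
      obtain ⟨a, ha, hda, b', hb', hab⟩ := h b.1 b.2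
        (congrArg Subtype.val ((toComplex_d_apply B n b).symm.trans hd))
      refine ⟨(⟨a, ha⟩ : A.deg (n + 1)), (toComplex_d_apply A n ⟨a, ha⟩).trans (Subtype.ext hda),
        (⟨b', hb'⟩ : B.deg (n + 2)), ?_⟩
      refine Eq.trans (Subtype.ext hab) (congrArg (Hom.restrict f (n + 1) ⟨a, ha⟩ + ·)
        (toComplex_d_apply B (n + 1) ⟨b', hb'⟩).symm)

/-- Along a trivial fibration, an element of degree `1` of the target lifts to an element of degree
`1` with any prescribed boundary lifting its boundary. -/
lemma exists_lift_of_trivialFibration {A B : CDGA S} {p : A ⟶ B}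
    (hp : trivialFibrations (CDGA S) p) {b : B.carrier} (hb : b ∈ B.deg 1) {a₀ : A.carrier}
    (ha₀ : a₀ ∈ A.deg 0) (h : B.d b = p.toAlgHom a₀) :
    ∃ a ∈ A.deg 1, p.toAlgHom a = b ∧ A.d a = a₀ := by
  obtain ⟨hfib, hwe⟩ := hp
  have hq : QuasiIso ((toComplex S).map p) := hwe
  -- Injectivity on `H⁰` makes `a₀` a boundary `d a'`. Then `b - p a'` is a cycle, which
  -- surjectivity on `H⁻¹` writes as `p z + d b₂`; finally `b₂` lifts because `p` is a fibration.
  obtain ⟨a', ha', hda'⟩ := ((quasiIsoAt_zero_iff p).1 (hq.quasiIsoAt 0)).1 a₀ ha₀ b hb h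
  obtain ⟨z, hz, hdz, b₂, hb₂, hzb⟩ := ((quasiIsoAt_succ_iff p 0).1 (hq.quasiIsoAt 1)).2
    (b - p.toAlgHom a') (sub_mem hb (p.map_deg ha')) (by
      rw [map_sub, h, ← p.map_d, hda', sub_self])
  obtain ⟨a₂, ha₂⟩ := hfib 2 two_pos ⟨b₂, hb₂⟩
  have ha₂' : p.toAlgHom a₂.1 = b₂ := congrArg Subtype.val ha₂
  refine ⟨a' + z + A.d a₂.1, add_mem (add_mem ha' hz) (A.d_mem a₂.2), ?_, ?_⟩
  · rw [map_add, map_add, p.map_d, ha₂', add_assoc, ← hzb, add_sub_cancel]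
  · rw [map_add, map_add, hda', hdz, A.d_d, add_zero, add_zero]

-- Used to replace a primitive of a homogeneous element by a homogeneous one.
open DirectSum in
lemma d_decompose (A : CDGA S) (a : A.carrier) (n : ℕ) :
    A.d (decompose A.deg a (n + 1)) = decompose A.deg (A.d a) n := by
  induction a using DirectSum.Decomposition.inductionOn A.deg with
  | zero => simp
  | add a b ha hb =>
    simp only [map_add, decompose_add, DirectSum.add_apply, Submodule.coe_add, ha, hb]
  | @homogeneous i a =>
    obtain ⟨a, ha⟩ := a
    cases i with
    | zero =>
      rw [A.d_zero ha, decompose_of_mem_ne A.deg ha (Nat.succ_ne_zero n).symm]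
      simp
    | succ i =>
      by_cases h : i = n
      · subst h
        rw [decompose_of_mem_same A.deg ha, decompose_of_mem_same A.deg (A.d_mem ha)]
      · rw [decompose_of_mem_ne A.deg ha (by omega), decompose_of_mem_ne A.deg (A.d_mem ha) h,
          map_zero]

end CDGA

/-! ### Partial derivatives on the symmetric algebra -/

namespace SymmetricAlgebra

variable {R M : Type*} [CommRing R] [AddCommGroup M] [Module R M]

/-- The algebra map `s ↦ s + ε ∂ₓ s`, where `∂ₓ` is the derivation extending the linear form `x`. -/
noncomputable def toDualNumber (x : Module.Dual R M) :
    SymmetricAlgebra R M →ₐ[R] DualNumber (SymmetricAlgebra R M) :=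
  lift ((TrivSqZeroExt.inlAlgHom R (SymmetricAlgebra R M) (SymmetricAlgebra R M)).toLinearMap ∘ₗ
      ι R M +
    (TrivSqZeroExt.inrHom (SymmetricAlgebra R M) (SymmetricAlgebra R M)).restrictScalars R ∘ₗ
      Algebra.linearMap R (SymmetricAlgebra R M) ∘ₗ x)

lemma fst_toDualNumber (x : Module.Dual R M) (s : SymmetricAlgebra R M) :
    (toDualNumber x s).fst = s := by
  have h : (TrivSqZeroExt.fstHom R (SymmetricAlgebra R M) (SymmetricAlgebra R M)).comp
      (toDualNumber x) = AlgHom.id R _ := by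
    refine algHom_ext (LinearMap.ext fun m => ?_)
    simp [toDualNumber]
  exact DFunLike.congr_fun h s

/-- The derivation of the symmetric algebra extending a linear form on the generators. -/
noncomputable def partialDeriv (x : Module.Dual R M) :
    SymmetricAlgebra R M →ₗ[R] SymmetricAlgebra R M :=
  (TrivSqZeroExt.sndHom (SymmetricAlgebra R M) (SymmetricAlgebra R M)).restrictScalars R ∘ₗ
    (toDualNumber x).toLinearMap

@[simp]
lemma partialDeriv_ι (x : Module.Dual R M) (m : M) :
    partialDeriv x (ι R M m) = algebraMap R _ (x m) := by
  simp [partialDeriv, toDualNumber, Algebra.algebraMap_eq_smul_one]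

@[simp]
lemma partialDeriv_algebraMap (x : Module.Dual R M) (r : R) :
    partialDeriv x (algebraMap R _ r) = 0 := by
  simp [partialDeriv, TrivSqZeroExt.algebraMap_eq_inl']

/-- The Leibniz rule is the `ε`-coefficient of the multiplicativity of `toDualNumber`. -/
lemma partialDeriv_mul (x : Module.Dual R M) (s t : SymmetricAlgebra R M) :
    partialDeriv x (s * t) = s * partialDeriv x t + t * partialDeriv x s := by
  simp [partialDeriv, fst_toDualNumber, mul_comm t]

end SymmetricAlgebra

/-! ### The de Rham homotopy and the Euler operators -/

namespace FancyKoszul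

variable {R P : Type u} [CommRing R] [AddCommGroup P] [Module R P]

open Module.Dual (eval)

/-- The operator `a ⊗ ω ↦ ∂ₓ a ⊗ α ∧ ω`. -/
noncomputable def coop (α : Module.Dual R P) (x : P) : KoszulAlg R P →ₗ[R] KoszulAlg R P :=
  TensorProduct.map (SymmetricAlgebra.partialDeriv (eval R P x))
    (LinearMap.mulLeft R (ExteriorAlgebra.ι R α))

lemma coop_tmul (α : Module.Dual R P) (x : P) (a : SymDual R P) (w : ExtDual R P) :
    coop α x (a ⊗ₜ w) =
      SymmetricAlgebra.partialDeriv (eval R P x) a ⊗ₜ (ExteriorAlgebra.ι R α * w) := rfl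

lemma contract_ι_mul (f : Module.Dual R (Module.Dual R P)) (α : Module.Dual R P)
    (w : ExtDual R P) : contract f (ExteriorAlgebra.ι R α * w) =
      f α • w - ExteriorAlgebra.ι R α * contract f w :=
  CliffordAlgebra.contractLeft_ι_mul f α w

/-- The mixed terms `α ∂_y a ⊗ β ∧ (x ⌟ w)` cancel, because contraction is an antiderivation and
`∂_y` a derivation. The scalars are kept inside `ι` so that sums over a dual basis collapse. -/
lemma op_coop_add_coop_op (α β : Module.Dual R P) (x y : P) (a : SymDual R P) (w : ExtDual R P) :
    op R P α x (coop β y (a ⊗ₜ w)) + coop β y (op R P α x (a ⊗ₜ w)) =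
      (SymmetricAlgebra.ι R _ (β x • α) * SymmetricAlgebra.partialDeriv (eval R P y) a) ⊗ₜ w +
      a ⊗ₜ (ExteriorAlgebra.ι R (α y • β) * contract (eval R P x) w) := by
  rw [coop_tmul, op_tmul, op_tmul, coop_tmul, contract_ι_mul, SymmetricAlgebra.partialDeriv_mul,
    SymmetricAlgebra.partialDeriv_ι, Module.Dual.eval_apply, Module.Dual.eval_apply,
    TensorProduct.tmul_sub, TensorProduct.add_tmul, TensorProduct.tmul_smul, map_smul, map_smul,
    smul_mul_assoc, smul_mul_assoc, TensorProduct.tmul_smul, TensorProduct.smul_tmul',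
    ← Algebra.commutes, ← Algebra.smul_def, ← TensorProduct.smul_tmul',
    mul_comm (SymmetricAlgebra.ι R _ α)]
  abel

/-- The Euler operator of the symmetric algebra. -/
noncomputable def symEuler {I : Type*} [Fintype I] (α : I → Module.Dual R P) (x : I → P) :
    SymDual R P →ₗ[R] SymDual R P :=
  ∑ i, LinearMap.mulLeft R (SymmetricAlgebra.ι R _ (α i)) ∘ₗ
    SymmetricAlgebra.partialDeriv (eval R P (x i))

/-- The Euler operator of the exterior algebra. -/
noncomputable def extEuler {I : Type*} [Fintype I] (α : I → Module.Dual R P) (x : I → P) :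
    ExtDual R P →ₗ[R] ExtDual R P :=
  ∑ i, LinearMap.mulLeft R (ExteriorAlgebra.ι R (α i)) ∘ₗ contract (eval R P (x i))

section Euler

variable {I : Type*} [Fintype I] {α : I → Module.Dual R P} {x : I → P}

lemma symEuler_mul (s t : SymDual R P) :
    symEuler α x (s * t) = s * symEuler α x t + t * symEuler α x s := by
  simp only [symEuler, LinearMap.sum_apply, LinearMap.comp_apply, LinearMap.mulLeft_apply,
    SymmetricAlgebra.partialDeriv_mul, Finset.mul_sum, ← Finset.sum_add_distrib]
  exact Finset.sum_congr rfl fun i _ => by ring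

lemma symEuler_algebraMap (r : R) : symEuler α x (algebraMap R _ r) = 0 := by
  simp [symEuler]

lemma extEuler_algebraMap (r : R) : extEuler α x (algebraMap R _ r) = 0 := by
  refine (LinearMap.sum_apply _ _ _).trans (Finset.sum_eq_zero fun i _ => ?_)
  rw [LinearMap.comp_apply, contract]
  erw [CliffordAlgebra.contractLeft_algebraMap]
  exact map_zero _

variable (hαx : ∀ β : Module.Dual R P, ∑ i, β (x i) • α i = β)
include hαx

lemma symEuler_ι (β : Module.Dual R P) :
    symEuler α x (SymmetricAlgebra.ι R _ β) = SymmetricAlgebra.ι R _ β := by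
  conv_rhs => rw [← hαx β]
  simp [symEuler, map_sum, Algebra.smul_def, mul_comm]

/-- Contracting `β` yields `∑ β(xᵢ) αᵢ = β`; in the other term, the sign of the antiderivation
cancels that of moving `αᵢ` past `β`. -/
lemma extEuler_ι_mul (β : Module.Dual R P) (w : ExtDual R P) :
    extEuler α x (ExteriorAlgebra.ι R β * w) =
      ExteriorAlgebra.ι R β * w + ExteriorAlgebra.ι R β * extEuler α x w := by
  have h (i) : ExteriorAlgebra.ι R (α i) * ExteriorAlgebra.ι R β =
      - (ExteriorAlgebra.ι R β * ExteriorAlgebra.ι R (α i)) :=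
    eq_neg_of_add_eq_zero_left (ExteriorAlgebra.ι_add_mul_swap _ _)
  have h' : ∑ i, β (x i) • (ExteriorAlgebra.ι R (α i) * w) = ExteriorAlgebra.ι R β * w := by
    conv_rhs => rw [← hαx β]
    simp only [map_sum, map_smul, Finset.sum_mul, smul_mul_assoc]
  simp only [extEuler, LinearMap.sum_apply, LinearMap.comp_apply, LinearMap.mulLeft_apply,
    contract_ι_mul, mul_sub, ← mul_assoc, h, neg_mul, sub_neg_eq_add, Finset.mul_sum,
    mul_smul_comm, Finset.sum_add_distrib, Module.Dual.eval_apply, h']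

lemma extEuler_of_mem {m : ℕ} {w : ExtDual R P} (hw : w ∈ ⋀[R]^m (Module.Dual R P)) :
    extEuler α x w = (m : R) • w := by
  induction hw using Submodule.pow_induction_on_left' with
  | algebraMap r => simp [extEuler_algebraMap]
  | add _ _ _ _ _ ihx ihy => rw [map_add, ihx, ihy, smul_add]
  | mem_mul z hz i y _ ih =>
    obtain ⟨β, rfl⟩ := hz
    rw [extEuler_ι_mul hαx, ih, Nat.cast_succ, add_smul, one_smul, mul_smul_comm, add_comm]

end Euler

end FancyKoszul

/-! ### Polynomials in a null-homotopic endomorphism -/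

namespace LinearMap

open Polynomial

variable {R K : Type*} [CommRing R] [AddCommGroup K] [Module R K]

/-- If an endomorphism `E = δ H + H δ` is homotopic to zero, a cycle is homologous to its image
under any polynomial in `E` with constant coefficient `1`. -/
lemma aeval_sub_mem_range_of_homotopy {δ H E : Module.End R K} (hδ : ∀ z, δ (δ z) = 0)
    (hE : ∀ z, E z = δ (H z) + H (δ z)) {p : R[X]} (hp : p.coeff 0 = 1) {z : K} (hz : δ z = 0) :
    aeval E p z - z ∈ range δ := by
  -- Both composites equal `δ H δ`.
  have hc : Commute δ E := LinearMap.ext fun y => by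
    simp [hE, hδ]
  have hcycle (q : R[X]) : δ (aeval E q z) = 0 := by
    induction q using Polynomial.induction_on' with
    | add p q hp hq => simp [hp, hq]
    | monomial n a =>
      have h : δ ((E ^ n) z) = (E ^ n) (δ z) := DFunLike.congr_fun (hc.pow_right n).eq z
      simp [aeval_monomial, h, hz]
  have h : p = X * p.divX + 1 := by
    conv_lhs => rw [← X_mul_divX_add p, hp, C_1]
  -- With `p = X q + 1`, the difference is `E (q(E) z) = δ H (q(E) z)`, since `q(E) z` is a cycle.
  refine ⟨H (aeval E p.divX z), ?_⟩
  conv_rhs => rw [h]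
  simp [hE, hcycle]

end LinearMap

/-! ### Acyclicity of the Koszul complex -/

namespace FancyKoszul

variable {R P : Type u} [CommRing R] [AddCommGroup P] [Module R P]

open Module.Dual (eval)

section Euler

variable {I : Type*} [Fintype I] {α : I → Module.Dual R P} {x : I → P}

/-- The Euler operator of the Koszul algebra, counting the generators in both tensor factors. -/
noncomputable def euler {I : Type*} [Fintype I] (α : I → Module.Dual R P) (x : I → P) :
    KoszulAlg R P →ₗ[R] KoszulAlg R P :=
  TensorProduct.map (symEuler α x) LinearMap.id + TensorProduct.map LinearMap.id (extEuler α x)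

lemma euler_tmul (a : SymDual R P) (w : ExtDual R P) :
    euler α x (a ⊗ₜ w) = symEuler α x a ⊗ₜ w + a ⊗ₜ extEuler α x w := rfl

lemma euler_algebraMap (r : R) : euler α x (algebraMap R _ r) = 0 := by
  rw [Algebra.TensorProduct.algebraMap_apply, euler_tmul, symEuler_algebraMap,
    ← map_one (algebraMap R (ExtDual R P)), extEuler_algebraMap, TensorProduct.zero_tmul,
    TensorProduct.tmul_zero, add_zero]

/-- The Euler operator is homotopic to zero. -/
lemma euler_eq (hαx : ∀ β : Module.Dual R P, ∑ i, β (x i) • α i = β) (z : KoszulAlg R P) :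
    euler α x z = opTensor R P (∑ i, α i ⊗ₜ x i) ((∑ i, coop (α i) (x i)) z) +
      (∑ i, coop (α i) (x i)) (opTensor R P (∑ i, α i ⊗ₜ x i) z) := by
  induction z using TensorProduct.induction_on with
  | zero => simp
  | add y z hy hz =>
    simp only [map_add, hy, hz]
    abel
  | tmul a w =>
    simp only [map_sum, LinearMap.sum_apply, opTensor_tmul]
    -- The two composites give double sums in opposite orders; one is exchanged so that they pair
    -- termwise.
    conv_rhs =>
      enter [2]
      rw [Finset.sum_comm]
    rw [← Finset.sum_add_distrib]
    simp only [← Finset.sum_add_distrib, op_coop_add_coop_op]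
    simp only [Finset.sum_add_distrib]
    rw [euler_tmul]
    congr 1
    · simp only [← TensorProduct.sum_tmul, ← Finset.sum_mul, ← map_sum, hαx]
      simp [symEuler]
    · rw [Finset.sum_comm]
      simp only [← TensorProduct.tmul_sum, ← Finset.sum_mul, ← map_sum, hαx]
      simp [extEuler]

/-- A substitute for the grading of `Sym`: the Euler operator is a derivation, so eigenvectors
multiply and their eigenvalues add. The last clause passes to products because a sum of natural
numbers vanishes only if both do. -/
lemma mem_span_symEuler (hαx : ∀ β : Module.Dual R P, ∑ i, β (x i) • α i = β) (a : SymDual R P) :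
    a ∈ Submodule.span R {s : SymDual R P | ∃ m : ℕ, symEuler α x s = (m : R) • s ∧
      (m = 0 → ∃ r, algebraMap R _ r = s)} := by
  induction a using SymmetricAlgebra.induction with
  | algebraMap r =>
    exact Submodule.subset_span ⟨0, by simp [symEuler_algebraMap], fun _ => ⟨r, rfl⟩⟩
  | ι β => exact Submodule.subset_span ⟨1, by simp [symEuler_ι hαx], by simp⟩
  | add a b ha hb => exact add_mem ha hb
  | mul a b ha hb =>
    have h := Submodule.mul_mem_mul ha hb
    rw [Submodule.span_mul_span] at h
    refine Submodule.span_mono ?_ h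
    rintro _ ⟨s, ⟨m, hs, hs'⟩, t, ⟨n, ht, ht'⟩, rfl⟩
    refine ⟨n + m, ?_, fun h => ?_⟩
    · simp only [symEuler_mul, hs, ht, mul_smul_comm, Nat.cast_add, add_smul, mul_comm t,
        smul_mul_assoc]
    · obtain ⟨r, rfl⟩ := hs' (by omega)
      obtain ⟨r', rfl⟩ := ht' (by omega)
      exact ⟨r * r', map_mul _ _ _⟩

variable (R P) in
lemma algebraMap_smul_algebraMap (r s : R) :
    r • algebraMap R (KoszulAlg R P) s = algebraMap R _ (r * s) := by
  rw [Algebra.algebraMap_eq_smul_one, Algebra.algebraMap_eq_smul_one, mul_smul]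

open Polynomial in
/-- Every element is sent to `R` by some polynomial in the Euler operator with constant
coefficient `1`. -/
lemma exists_aeval_euler (hαx : ∀ β : Module.Dual R P, ∑ i, β (x i) • α i = β)
    (hR : ∀ n : ℕ, n ≠ 0 → IsUnit (n : R)) (z : KoszulAlg R P) :
    ∃ p : R[X], p.coeff 0 = 1 ∧ ∃ r, aeval (euler α x) p z = algebraMap R _ r := by
  -- The Euler operator kills constants, so `p(E)` acts on them through `p(0)`.
  have hstable (p : R[X]) (r : R) : aeval (euler α x) p (algebraMap R (KoszulAlg R P) r) =
      algebraMap R _ (p.coeff 0 * r) := by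
    conv_lhs => rw [← divX_mul_X_add p]
    rw [map_add, map_mul, aeval_X, aeval_C, LinearMap.add_apply, Module.End.mul_apply,
      euler_algebraMap, map_zero, zero_add, Module.algebraMap_end_apply,
      algebraMap_smul_algebraMap]
  have hadd (y z : KoszulAlg R P)
      (hy : ∃ p : R[X], p.coeff 0 = 1 ∧ ∃ r, aeval (euler α x) p y = algebraMap R _ r)
      (hz : ∃ p : R[X], p.coeff 0 = 1 ∧ ∃ r, aeval (euler α x) p z = algebraMap R _ r) :
      ∃ p : R[X], p.coeff 0 = 1 ∧ ∃ r, aeval (euler α x) p (y + z) = algebraMap R _ r := by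
    obtain ⟨p, hp, r, hr⟩ := hy
    obtain ⟨q, hq, s, hs⟩ := hz
    -- On either summand, one factor produces a constant, which the other factor fixes.
    refine ⟨p * q, by rw [mul_coeff_zero, hp, hq, one_mul], r + s, ?_⟩
    rw [map_add, map_add]
    congr 1
    · rw [mul_comm, map_mul, Module.End.mul_apply, hr, hstable, hq, one_mul]
    · rw [map_mul, Module.End.mul_apply, hs, hstable, hp, one_mul]
  have hzero : ∃ p : R[X], p.coeff 0 = 1 ∧ ∃ r,
      aeval (euler α x) p 0 = algebraMap R (KoszulAlg R P) r :=
    ⟨1, coeff_one_zero, 0, by simp⟩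
  induction z using TensorProduct.induction_on with
  | zero => exact hzero
  | add y z hy hz => exact hadd y z hy hz
  | tmul a w =>
    induction w using DirectSum.Decomposition.inductionOn (fun n => ⋀[R]^n (Module.Dual R P)) with
    | zero => rwa [TensorProduct.tmul_zero]
    | add v w hv hw =>
      rw [TensorProduct.tmul_add]
      exact hadd _ _ hv hw
    | @homogeneous n w =>
      obtain ⟨w, hw⟩ := w
      induction mem_span_symEuler hαx a using Submodule.span_induction with
      | zero => rwa [TensorProduct.zero_tmul]
      | add a b _ _ ha hb =>
        rw [TensorProduct.add_tmul]
        exact hadd _ _ ha hb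
      | smul r a _ ha =>
        obtain ⟨p, hp, s, hs⟩ := ha
        refine ⟨p, hp, r * s, ?_⟩
        rw [← TensorProduct.smul_tmul', map_smul, hs, algebraMap_smul_algebraMap]
      | mem a ha =>
        obtain ⟨m, ha, ha'⟩ := ha
        by_cases hmn : m + n = 0
        · obtain ⟨r, rfl⟩ := ha' (by omega)
          obtain rfl : n = 0 := by omega
          rw [ExteriorAlgebra.exteriorPower, pow_zero] at hw
          obtain ⟨s, rfl⟩ := Submodule.mem_one.1 hw
          refine ⟨1, coeff_one_zero, r * s, ?_⟩
          rw [map_one, Module.End.one_apply, map_mul, Algebra.TensorProduct.algebraMap_apply,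
            Algebra.TensorProduct.algebraMap_apply', Algebra.TensorProduct.tmul_mul_tmul, one_mul,
            mul_one]
        · obtain ⟨v, hv⟩ := (hR _ hmn).exists_left_inv
          -- The vector has eigenvalue `m + n`, with inverse `v`, so this polynomial kills it.
          refine ⟨1 - C v * X, by simp, 0, ?_⟩
          have he : euler α x (a ⊗ₜ w) = ((m + n : ℕ) : R) • (a ⊗ₜ[R] w) := by
            rw [euler_tmul, ha, extEuler_of_mem hαx hw, TensorProduct.tmul_smul,
              ← TensorProduct.smul_tmul', Nat.cast_add, add_smul]
          simp only [map_sub, map_one, map_mul, aeval_C, aeval_X, LinearMap.sub_apply,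
            Module.End.one_apply, Module.End.mul_apply, he, Module.algebraMap_end_apply, smul_smul,
            hv, one_smul, sub_self, map_zero]

end Euler

variable [Module.Finite R P] [Module.Projective R P]

variable (R P) in
/-- A dual basis of `P`, given by the coevaluation. -/
lemma exists_dual_basis : ∃ s : Finset (Module.Dual R P × P),
    coev R P = ∑ i : s, i.1.1 ⊗ₜ[R] i.1.2 ∧
      ∀ β : Module.Dual R P, ∑ i : s, β i.1.2 • i.1.1 = β := by
  obtain ⟨s, hs⟩ := TensorProduct.exists_finset (coev R P)
  rw [← Finset.sum_coe_sort] at hs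
  refine ⟨s, hs, fun β => LinearMap.ext fun p => ?_⟩
  have h : dualTensorHom R P P (coev R P) = LinearMap.id := by
    exact (dualTensorHomEquiv R P P).apply_symm_apply LinearMap.id
  have hp := congrArg β (DFunLike.congr_fun h p)
  rw [hs] at hp
  simpa [mul_comm] using hp

/-- Every cycle of the Koszul complex is homologous to a constant. -/
lemma exists_eq_algebraMap_add_differential (hR : ∀ n : ℕ, n ≠ 0 → IsUnit (n : R))
    {z : KoszulAlg R P} (hz : differential R P z = 0) :
    ∃ r y, z = algebraMap R _ r + differential R P y := by
  obtain ⟨s, hs, hαx⟩ := exists_dual_basis R P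
  obtain ⟨p, hp, r, hr⟩ := exists_aeval_euler hαx hR z
  -- Applied to `δ = -d`; the sign changes neither cycles nor boundaries.
  obtain ⟨y, hy⟩ := LinearMap.aeval_sub_mem_range_of_homotopy (H := ∑ i : s, coop i.1.1 i.1.2)
    (δ := (opTensor R P (coev R P)).restrictScalars R) (opTensor_opTensor_self _)
    (fun z => by rw [euler_eq hαx z, ← hs]; rfl) hp (neg_eq_zero.1 hz)
  refine ⟨r, y, ?_⟩
  have hy' : opTensor R P (coev R P) y = algebraMap R _ r - z := by rw [← hr]; exact hy
  rw [differential_apply, hy', neg_sub, add_sub_cancel]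

omit [Module.Finite R P] [Module.Projective R P] in
lemma aug_algebraMap (r : R) : aug R P (algebraMap R _ r) = algebraMap R (ZeroSection R P) r := by
  exact AlgHom.commutes ((aug R P).restrictScalars R) r

/-- A cycle of the Koszul complex killed by the augmentation is a boundary. -/
lemma exists_differential_eq (hR : ∀ n : ℕ, n ≠ 0 → IsUnit (n : R)) {n : ℕ}
    {z : KoszulAlg R P} (hz : z ∈ deg R P n) (hd : differential R P z = 0) (ha : aug R P z = 0) :
    ∃ y ∈ deg R P (n + 1), differential R P y = z := by
  obtain ⟨r, y, rfl⟩ := exists_eq_algebraMap_add_differential hR hd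
  have hr : r = 0 := by
    rw [map_add, aug_differential, add_zero, aug_algebraMap] at ha
    exact ha
  rw [hr, map_zero, zero_add] at hz ⊢
  -- The primitive `y` need not be homogeneous; its component of degree `n + 1` has the same
  -- boundary, as `z` lives in degree `n`.
  refine ⟨DirectSum.decompose (deg R P) y (n + 1), SetLike.coe_mem _, ?_⟩
  exact ((fancyKoszul R P).d_decompose y n).trans (DirectSum.decompose_of_mem_same (deg R P) hz)

lemma fibration_augmentation : Fibration (augmentation R P) := by
  refine ⟨fun n hn b => ⟨0, Subtype.ext ?_⟩⟩
  exact (map_zero _).trans (CDGA.eq_zero_of_mem_trivialDeg (B := ZeroSection R P) hn.ne' b.2).symm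

lemma exactAt_fancyKoszul (hR : ∀ n : ℕ, n ≠ 0 → IsUnit (n : R)) (n : ℕ) :
    ((CDGA.toComplex _).obj (fancyKoszul R P)).ExactAt (n + 1) :=
  (CDGA.exactAt_succ_iff _ n).2 fun _ ha hd => exists_differential_eq hR ha hd (aug_eq_zero ha)

omit [Module.Finite R P] [Module.Projective R P] in
variable (R P) in
lemma exactAt_cdga (n : ℕ) :
    ((CDGA.toComplex _).obj (ZeroSection.cdga R P)).ExactAt (n + 1) :=
  (CDGA.exactAt_succ_iff _ n).2 fun _ ha _ => ⟨0, zero_mem _, (map_zero _).trans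
    (CDGA.eq_zero_of_mem_trivialDeg (B := ZeroSection R P) n.succ_ne_zero ha).symm⟩

lemma quasiIso_augmentation (hR : ∀ n : ℕ, n ≠ 0 → IsUnit (n : R)) :
    QuasiIso ((CDGA.toComplex _).map (augmentation R P)) := by
  refine ⟨fun n => ?_⟩
  cases n with
  | zero =>
    refine (CDGA.quasiIsoAt_zero_iff _).2 ⟨fun a ha b _ h => ?_, fun b _ => ?_⟩
    -- The target has zero differential, so `h` says that the augmentation kills `a`.
    · exact exists_differential_eq hR ha ((fancyKoszul R P).d_zero ha) h.symm
    · refine ⟨algebraMap (SymDual R P) (KoszulAlg R P)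
        (algebraMap R (SymDual R P) (show R from b)),
        SetLike.algebraMap_mem_graded (deg R P) _, 0, zero_mem _, ?_⟩
      refine Eq.symm ((add_zero _).trans ?_)
      exact aug_algebraMap (R := R) (P := P) b
  | succ n =>
    exact (quasiIsoAt_iff_exactAt' _ _ (exactAt_cdga R P n)).2 (exactAt_fancyKoszul hR n)

end FancyKoszul

/-! ### Morphisms out of the Koszul cdga and cofibrancy -/

namespace FancyKoszul

variable {R P : Type u} [CommRing R] [AddCommGroup P] [Module R P]

variable [Module.Finite R P] [Module.Projective R P]

open Module.Dual (eval)

/-- The contractions are the scalars `β(xᵢ)`, and `∑ β(xᵢ) αᵢ = β`. -/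
lemma differential_one_tmul_ι (β : Module.Dual R P) :
    differential R P (1 ⊗ₜ ExteriorAlgebra.ι R β) =
      - algebraMap (SymDual R P) (KoszulAlg R P) (SymmetricAlgebra.ι R _ β) := by
  obtain ⟨s, hs, hαx⟩ := exists_dual_basis R P
  have h (x : P) : contract (eval R P x) (ExteriorAlgebra.ι R β) = algebraMap R _ (β x) :=
    CliffordAlgebra.contractLeft_ι (Q := (0 : QuadraticForm R (Module.Dual R P))) _ β
  rw [differential_apply, hs]
  congr 1
  conv_rhs => rw [← hαx β]
  simp only [map_sum, LinearMap.sum_apply, opTensor_tmul, op_tmul, one_mul, h, map_smul,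
    Algebra.algebraMap_eq_smul_one, TensorProduct.tmul_smul, TensorProduct.smul_tmul',
    Algebra.TensorProduct.one_def, smul_eq_mul, mul_one]

section OfGenerators

variable {A : CDGA (SymDual R P)} [Algebra R A.carrier] [IsScalarTower R (SymDual R P) A.carrier]
  (φ : Module.Dual R P →ₗ[R] A.carrier) (hsq : ∀ β, φ β * φ β = 0)

/-- The morphism of algebras out of the Koszul algebra with given values on the generators. -/
noncomputable def liftAlgHom : KoszulAlg R P →ₐ[SymDual R P] A.carrier :=
  Algebra.TensorProduct.lift (Algebra.ofId (SymDual R P) A.carrier)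
    (ExteriorAlgebra.lift R ⟨φ, hsq⟩) (fun s _ => Algebra.commutes s _)

omit [Module.Finite R P] [Module.Projective R P] in
lemma liftAlgHom_one_tmul (w : ExtDual R P) :
    liftAlgHom φ hsq (1 ⊗ₜ w) = ExteriorAlgebra.lift R ⟨φ, hsq⟩ w := by
  exact (Algebra.TensorProduct.lift_tmul _ _ _ _ _).trans (by rw [map_one, one_mul])

omit [Module.Finite R P] [Module.Projective R P] in
lemma liftAlgHom_one_tmul_ι (β : Module.Dual R P) :
    liftAlgHom φ hsq (1 ⊗ₜ ExteriorAlgebra.ι R β) = φ β := by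
  rw [liftAlgHom_one_tmul, ExteriorAlgebra.lift_ι_apply]

omit [Module.Finite R P] [Module.Projective R P] in
lemma liftAlgHom_mem (hφ : ∀ β, φ β ∈ A.deg 1) {n : ℕ} {z : KoszulAlg R P} (hz : z ∈ deg R P n) :
    liftAlgHom φ hsq z ∈ A.deg n := by
  rw [deg_eq_span] at hz
  induction hz using Submodule.span_induction with
  | zero => simp
  | add y z _ _ hy hz => rw [map_add]; exact add_mem hy hz
  | smul s z _ hz => rw [map_smul]; exact Submodule.smul_mem _ _ hz
  | mem z hz =>
    obtain ⟨w, hw, rfl⟩ := hz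
    rw [TensorProduct.mk_apply, liftAlgHom_one_tmul]
    induction hw using Submodule.pow_induction_on_left' with
    | algebraMap r =>
      rw [AlgHom.commutes, IsScalarTower.algebraMap_apply R (SymDual R P) A.carrier]
      exact SetLike.algebraMap_mem_graded A.deg _
    | add _ _ _ _ _ ihx ihy => rw [map_add]; exact add_mem ihx ihy
    | mem_mul x hx i y _ ih =>
      obtain ⟨β, rfl⟩ := hx
      rw [map_mul, ExteriorAlgebra.lift_ι_apply, Nat.succ_eq_one_add]
      exact SetLike.mul_mem_graded (hφ β) ih

/-- Both sides are `S`-linear and obey the same signed Leibniz rule, so agreement on the generators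
suffices. -/
lemma liftAlgHom_differential (hφ : ∀ β, φ β ∈ A.deg 1)
    (hd : ∀ β, A.d (φ β) = - algebraMap (SymDual R P) A.carrier (SymmetricAlgebra.ι R _ β))
    (z : KoszulAlg R P) :
    liftAlgHom φ hsq (differential R P z) = A.d (liftAlgHom φ hsq z) := by
  induction z using TensorProduct.induction_on with
  | zero => simp
  | add y z hy hz => simp only [map_add, hy, hz]
  | tmul s w =>
    suffices h : liftAlgHom φ hsq (differential R P (1 ⊗ₜ w)) =
        A.d (liftAlgHom φ hsq (1 ⊗ₜ w)) by
      rw [show s ⊗ₜ[R] w = s • (1 ⊗ₜ[R] w) by rw [TensorProduct.smul_tmul', smul_eq_mul, mul_one]]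
      simp only [map_smul, h]
    induction w using CliffordAlgebra.left_induction with
    | algebraMap r =>
      have h0 : (1 : SymDual R P) ⊗ₜ[R] algebraMap R (ExtDual R P) r ∈ deg R P 0 :=
        Submodule.tmul_mem_baseChange_of_mem _
          (SetLike.algebraMap_mem_graded (fun n => ⋀[R]^n (Module.Dual R P)) r)
      exact ((congrArg _ ((fancyKoszul R P).d_zero h0)).trans (map_zero _)).trans
        (A.d_zero (liftAlgHom_mem φ hsq hφ h0)).symm
    | add v w hv hw => simp only [TensorProduct.tmul_add, map_add, hv, hw]
    | ι_mul w β hw =>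
      have hβ : (1 : SymDual R P) ⊗ₜ[R] ExteriorAlgebra.ι R β ∈ deg R P 1 :=
        Submodule.tmul_mem_baseChange_of_mem _ (by
          rw [ExteriorAlgebra.exteriorPower, pow_one]
          exact ⟨β, rfl⟩)
      have h : (1 : SymDual R P) ⊗ₜ[R] (ExteriorAlgebra.ι R β * w) =
          (1 ⊗ₜ ExteriorAlgebra.ι R β) * (1 ⊗ₜ w) := by
        rw [Algebra.TensorProduct.tmul_mul_tmul, one_mul]
      change liftAlgHom φ hsq (differential R P (1 ⊗ₜ (ExteriorAlgebra.ι R β * w))) =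
        A.d (liftAlgHom φ hsq (1 ⊗ₜ (ExteriorAlgebra.ι R β * w)))
      rw [h, differential_leibniz R P _ hβ, map_mul, liftAlgHom_one_tmul_ι, A.leibniz _ (hφ β), hd,
        ← hw, differential_one_tmul_ι]
      simp only [map_add, map_mul, map_neg, map_pow, map_one, AlgHom.commutes,
        liftAlgHom_one_tmul_ι]

/-- The morphism of cdga's out of the Koszul cdga with given values on the generators. -/
noncomputable def liftHom (hφ : ∀ β, φ β ∈ A.deg 1)
    (hd : ∀ β, A.d (φ β) = - algebraMap (SymDual R P) A.carrier (SymmetricAlgebra.ι R _ β)) :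
    fancyKoszul R P ⟶ A :=
  CDGA.Hom.mk (A := fancyKoszul R P) (liftAlgHom φ hsq) (liftAlgHom_mem φ hsq hφ)
    (liftAlgHom_differential φ hsq hφ hd)

end OfGenerators

lemma fancyKoszul_hom_ext {A : CDGA (SymDual R P)} {f g : fancyKoszul R P ⟶ A}
    (h : ∀ β : Module.Dual R P, f.toAlgHom ((1 : SymDual R P) ⊗ₜ[R] ExteriorAlgebra.ι R β) =
      g.toAlgHom ((1 : SymDual R P) ⊗ₜ[R] ExteriorAlgebra.ι R β)) : f = g := by
  let _ : Algebra R A.carrier := Algebra.compHom A.carrier (algebraMap R (SymDual R P))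
  have : IsScalarTower R (SymDual R P) A.carrier := .of_algebraMap_eq fun _ => rfl
  refine CDGA.Hom.ext (Algebra.TensorProduct.ext (R := R) (Subsingleton.elim _ _) ?_)
  exact ExteriorAlgebra.hom_ext (LinearMap.ext h)

/-- The Koszul cdga has the left lifting property with respect to the trivial fibrations. -/
lemma exists_lift (h2 : IsUnit (2 : R)) {A B : CDGA (SymDual R P)} {p : A ⟶ B}
    (hp : trivialFibrations (CDGA (SymDual R P)) p) (g : fancyKoszul R P ⟶ B) :
    ∃ l : fancyKoszul R P ⟶ A, l ≫ p = g := by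
  let _ : Algebra R A.carrier := Algebra.compHom A.carrier (algebraMap R (SymDual R P))
  have : IsScalarTower R (SymDual R P) A.carrier := .of_algebraMap_eq fun _ => rfl
  let _ : Algebra R B.carrier := Algebra.compHom B.carrier (algebraMap R (SymDual R P))
  have : IsScalarTower R (SymDual R P) B.carrier := .of_algebraMap_eq fun _ => rfl
  let N : Submodule R A.carrier := (A.deg 1).restrictScalars R
  -- A lift of the generator `β` is a preimage under `q = (p, d)` of the pair `(g β, -β)`, which is
  -- `γ.prod σ β`.
  let q : N →ₗ[R] B.carrier × A.carrier :=
    ((p.toAlgHom.toLinearMap.restrictScalars R).prod (A.d.restrictScalars R)).domRestrict N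
  let g' : KoszulAlg R P →ₗ[SymDual R P] B.carrier := g.toAlgHom.toLinearMap
  let γ : Module.Dual R P →ₗ[R] B.carrier :=
    (g'.restrictScalars R) ∘ₗ (TensorProduct.mk R (SymDual R P) (ExtDual R P) 1) ∘ₗ ExteriorAlgebra.ι R
  let σ : Module.Dual R P →ₗ[R] A.carrier :=
    - ((Algebra.linearMap (SymDual R P) A.carrier).restrictScalars R ∘ₗ SymmetricAlgebra.ι R _)
  have hβ (β : Module.Dual R P) : (1 : SymDual R P) ⊗ₜ[R] ExteriorAlgebra.ι R β ∈ deg R P 1 :=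
    Submodule.tmul_mem_baseChange_of_mem _ (by
      rw [ExteriorAlgebra.exteriorPower, pow_one]
      exact ⟨β, rfl⟩)
  have hmem (β : Module.Dual R P) : γ.prod σ β ∈ LinearMap.range q := by
    have hdγ : B.d (γ β) = p.toAlgHom (σ β) := by
      have h1 : B.d (γ β) = g.toAlgHom (differential R P (1 ⊗ₜ ExteriorAlgebra.ι R β)) :=
        (g.map_d _).symm
      have h2 : p.toAlgHom (σ β) = - algebraMap _ _ (SymmetricAlgebra.ι R _ β) := by
        refine (map_neg _ _).trans (congrArg _ (AlgHom.commutes _ _))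
      rw [h1, h2, differential_one_tmul_ι]
      exact (map_neg _ _).trans (congrArg _ (AlgHom.commutes _ _))
    obtain ⟨a, ha, hpa, hda⟩ := CDGA.exists_lift_of_trivialFibration hp (g.map_deg (hβ β))
      (neg_mem (SetLike.algebraMap_mem_graded A.deg _)) hdγ
    exact ⟨⟨a, ha⟩, Prod.ext hpa hda⟩
  -- The dual `P^∨` is projective, so the elementwise preimages can be chosen linearly.
  obtain ⟨ψ, hψ⟩ := Module.projective_lifting_property q.rangeRestrict
    ((γ.prod σ).codRestrict _ hmem) q.surjective_rangeRestrict
  have hψ' (β : Module.Dual R P) : q (ψ β) = γ.prod σ β :=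
    congrArg Subtype.val (DFunLike.congr_fun hψ β)
  -- Graded commutativity in odd degree only gives `2 (ψ β)² = 0`; here 2 has to be invertible.
  have hsq (β : Module.Dual R P) : (N.subtype ∘ₗ ψ) β * (N.subtype ∘ₗ ψ) β = 0 := by
    have h := A.graded_comm (ψ β).2 (ψ β).2
    rw [mul_one, pow_one, neg_one_mul, eq_neg_iff_add_eq_zero, ← two_smul R] at h
    exact h2.smul_eq_zero.1 h
  refine ⟨liftHom (N.subtype ∘ₗ ψ) hsq (fun β => (ψ β).2)
    (fun β => congrArg Prod.snd (hψ' β)), fancyKoszul_hom_ext fun β => ?_⟩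
  refine Eq.trans (congrArg p.toAlgHom (liftAlgHom_one_tmul_ι (N.subtype ∘ₗ ψ) hsq β)) ?_
  exact congrArg Prod.fst (hψ' β)

lemma isCofibrant_fancyKoszul (h2 : IsUnit (2 : R)) : IsCofibrant (fancyKoszul R P) := by
  refine ⟨fun A B p hp => ⟨fun {f g} sq => ?_⟩⟩
  obtain ⟨l, hl⟩ := exists_lift h2 hp g
  -- The upper triangle commutes because its source is initial.
  exact ⟨⟨l, initial.hom_ext _ _, hl⟩⟩

variable (R P) in
omit [Module.Finite R P] [Module.Projective R P] in
/-- The cohomology in degree `0` of an algebra concentrated in degree `0`. -/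
lemma nonempty_homology_cdga_iso :
    Nonempty (((CDGA.toComplex _).obj (ZeroSection.cdga R P)).homology 0 ≅
      ModuleCat.of (SymDual R P) (ZeroSection R P)) := by
  let K := (CDGA.toComplex _).obj (ZeroSection.cdga R P)
  have h1 : K.d 1 0 = 0 := by
    rw [CDGA.toComplex_d]
    rfl
  have h0 : K.d 0 0 = 0 := K.shape _ _ (by simp)
  let e : K.X 0 ≅ ModuleCat.of (SymDual R P) (ZeroSection R P) :=
    (LinearEquiv.ofTop (CDGA.trivialDeg (SymDual R P) (ZeroSection R P) 0) rfl).toModuleIso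
  exact ⟨(K.isoHomologyπ 1 0 (by simp) h1).symm ≪≫ K.iCyclesIso 0 0 (by simp) h0 ≪≫ e⟩

end FancyKoszul

theorem mainTheorem10 (k : Type v) [Field k] [CharZero k] (R : Type u) [CommRing R] [Algebra k R]
    (P : Type u) [AddCommGroup P] [Module R P] [Module.Finite R P] [Module.Projective R P] :
    IsCofibrant (fancyKoszul R P) ∧
    WeakEquivalence (FancyKoszul.augmentation R P) ∧
    Fibration (FancyKoszul.augmentation R P) ∧
    (∀ n : ℕ, 0 < n → ((CDGA.toComplex _).obj (fancyKoszul R P)).ExactAt n) ∧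
    Nonempty (((CDGA.toComplex _).obj (fancyKoszul R P)).homology 0 ≅
      ModuleCat.of (FancyKoszul.SymDual R P) (ZeroSection R P)) := by
  -- Characteristic zero enters only here.
  have hR (n : ℕ) (hn : n ≠ 0) : IsUnit (n : R) := by
    rw [← map_natCast (algebraMap k R)]
    exact (IsUnit.mk0 _ (Nat.cast_ne_zero.2 hn)).map _
  have hq := FancyKoszul.quasiIso_augmentation (P := P) hR
  refine ⟨FancyKoszul.isCofibrant_fancyKoszul (hR 2 two_ne_zero), ⟨hq⟩,
    FancyKoszul.fibration_augmentation, fun n hn => ?_, ?_⟩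
  · obtain ⟨m, rfl⟩ := Nat.exists_eq_succ_of_ne_zero hn.ne'
    exact FancyKoszul.exactAt_fancyKoszul hR m
  · obtain ⟨e⟩ := FancyKoszul.nonempty_homology_cdga_iso R P
    exact ⟨isoOfQuasiIsoAt ((CDGA.toComplex _).map (FancyKoszul.augmentation R P)) 0 ≪≫ e⟩
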